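/- Let $n\ge 1$, and for each $i\in\{1,\dots,n\}$ let $t_i>0$ and $q_i\in(0,1)$. A hider hides in one of $n$ boxes; a searcher searches boxes one at a time, following a search sequence $\xi\in\mathcal C:=\{1,\dots,n\}^\infty$. Each search of box $i$ takes time $t_i$ and, if the hider is in box $i$, finds the hider with probability $q_i$, independently of earlier searches. Let $V_i(\xi)\in[0,\infty]$ be the expected time until the hider is found when the hider is in box $i$ and the searcher follows $\xi$ (the time is $\infty$ if the hider is never found). A mixed hiding strategy is a probability vector $\mathbf p=(p_1,\dots,p_n)$. A mixed search strategy is a function $\eta:\mathcal C\to[0,1]$ with countable support and $\sum_{\xi}\eta(\xi)=1$; it is called a mixture of the $\xi$ with $\eta(\xi)>0$, and $V_i(\eta):=\sum_\xi \eta(\xi)V_i(\xi)$. Put $$v_1=\sup_{\mathbf p}\inf_{\xi\in\mathcal C}\sum_{i=1}^n p_iV_i(\xi),\qquad v_2=\inf_{\eta}\max_{1\le i\le n}V_i(\eta),$$ with $0\cdot\infty=0$. A mixed hiding strategy $\mathbf p$ is optimal if $\inf_{\xi}\sum_i p_iV_i(\xi)=v_1$, and a mixed search strategy $\eta$ is optimal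 if $\max_iV_i(\eta)=v_2$. A Gittins search sequence against $\mathbf p$ is a $\xi\in\mathcal C$ such that, at every stage, if $m_i\in\{0,1,2,\dots\}$ searches of box $i$ have been made so far ($i=1,\dots,n$), then the next box searched is some $j$ that maximizes $p_i(1-q_i)^{m_i}q_i/t_i$ over $i\in\{1,\dots,n\}$. **Theorem.** The game has a value, $v_1=v_2$, and the searcher has an optimal strategy. Moreover, for every optimal hiding strategy $\mathbf p^*$ there is an optimal search strategy that is a mixture of at most $n$ Gittins search sequences against $\mathbf p^*$. -/

import Mathlib

open scoped ENNReal

namespace SearchGame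

/-- A pure search strategy: an infinite ordered list of boxes; `ξ k` is the box searched at
search number `k`, counting from `0`. -/
abbrev SearchSeq (n : ℕ) : Type := ℕ → Fin n

/-- The number of searches of box `i` among the first `k` searches of `ξ`. -/
def searchCount {n : ℕ} (ξ : SearchSeq n) (k : ℕ) (i : Fin n) : ℕ :=
  ((Finset.range k).filter (fun j => ξ j = i)).card

/-- The total time taken by the first `k` searches of `ξ`. -/
def elapsedTime {n : ℕ} (t : Fin n → ℝ) (ξ : SearchSeq n) (k : ℕ) : ℝ :=
  ∑ j ∈ Finset.range k, t (ξ j)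

/-- The probability that a hider in box `i` is not found by the first `k` searches of `ξ`. -/
noncomputable def survivalProb {n : ℕ} (q : Fin n → ℝ) (ξ : SearchSeq n) (i : Fin n) (k : ℕ) :
    ℝ≥0∞ :=
  ENNReal.ofReal ((1 - q i) ^ searchCount ξ k i)

/-- The probability that a hider in box `i` is found exactly at search number `k` of `ξ`. -/
noncomputable def detectionProb {n : ℕ} (q : Fin n → ℝ) (ξ : SearchSeq n) (i : Fin n) (k : ℕ) :
    ℝ≥0∞ :=
  if ξ k = i then survivalProb q ξ i k * ENNReal.ofReal (q i) else 0

/-- `V_i(ξ)`: the expected time to detection when the hider is in box `i` and the searcher uses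
`ξ`. The detection time equals the total time of searches `0, …, k` if the hider is found at
search number `k`, and is infinite if the hider is never found, an event whose probability is
the infimum of the survival probabilities (in `ℝ≥0∞` one has `⊤ * 0 = 0`). -/
noncomputable def expectedTime {n : ℕ} (t q : Fin n → ℝ) (ξ : SearchSeq n) (i : Fin n) : ℝ≥0∞ :=
  (∑' k : ℕ, detectionProb q ξ i k * ENNReal.ofReal (elapsedTime t ξ (k + 1))) +
    ⊤ * ⨅ k : ℕ, survivalProb q ξ i k

/-- The expected time to detection when the hider uses the mixed strategy `p` and the searcher
uses `ξ`. -/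
noncomputable def hiderPayoff {n : ℕ} (t q p : Fin n → ℝ) (ξ : SearchSeq n) : ℝ≥0∞ :=
  ∑ i, ENNReal.ofReal (p i) * expectedTime t q ξ i

/-- The expected time to detection guaranteed by the mixed hiding strategy `p`. -/
noncomputable def hiderGuarantee {n : ℕ} (t q p : Fin n → ℝ) : ℝ≥0∞ :=
  ⨅ ξ : SearchSeq n, hiderPayoff t q p ξ

/-- `V_i(η)`: the expected time to detection when the hider is in box `i` and the searcher uses
the mixed strategy `η`. A `PMF` on search sequences is a nonnegative function with sum `1`; its
support is automatically countable. -/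
noncomputable def mixedTime {n : ℕ} (t q : Fin n → ℝ) (η : PMF (SearchSeq n)) (i : Fin n) :
    ℝ≥0∞ :=
  ∑' ξ : SearchSeq n, η ξ * expectedTime t q ξ i

/-- The worst-case expected time to detection under the mixed search strategy `η`. -/
noncomputable def searcherGuarantee {n : ℕ} (t q : Fin n → ℝ) (η : PMF (SearchSeq n)) : ℝ≥0∞ :=
  ⨆ i, mixedTime t q η i

/-- The lower value `v₁` of the game (mixed hiding strategies are probability vectors). -/
noncomputable def lowerValue {n : ℕ} (t q : Fin n → ℝ) : ℝ≥0∞ :=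
  ⨆ p ∈ stdSimplex ℝ (Fin n), hiderGuarantee t q p

/-- The upper value `v₂` of the game. -/
noncomputable def upperValue {n : ℕ} (t q : Fin n → ℝ) : ℝ≥0∞ :=
  ⨅ η : PMF (SearchSeq n), searcherGuarantee t q η

/-- A mixed hiding strategy is optimal if its guarantee attains the lower value. -/
def IsOptimalHiding {n : ℕ} (t q p : Fin n → ℝ) : Prop :=
  p ∈ stdSimplex ℝ (Fin n) ∧ hiderGuarantee t q p = lowerValue t q

/-- A mixed search strategy is optimal if its guarantee attains the upper value. -/
def IsOptimalSearch {n : ℕ} (t q : Fin n → ℝ) (η : PMF (SearchSeq n)) : Prop :=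
  searcherGuarantee t q η = upperValue t q

/-- The Gittins index of box `i` against `p` after `m` searches of box `i`. -/
noncomputable def gittinsIndex {n : ℕ} (t q p : Fin n → ℝ) (i : Fin n) (m : ℕ) : ℝ :=
  p i * (1 - q i) ^ m * q i / t i

/-- `ξ` is a Gittins search sequence against `p`: every search is of a box of maximal current
Gittins index, ties being broken arbitrarily. -/
def IsGittins {n : ℕ} (t q p : Fin n → ℝ) (ξ : SearchSeq n) : Prop :=
  ∀ k : ℕ, ∀ i : Fin n,
    gittinsIndex t q p i (searchCount ξ k i) ≤
      gittinsIndex t q p (ξ k) (searchCount ξ k (ξ k))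

end SearchGame

namespace SearchGame

open Filter Topology

/-! ### Search counts -/

/-! Two ideas carry the theorem: a pairwise exchange argument, which makes Gittins sequences best
responses, and a perturbation of an optimal hiding strategy, which makes some Gittins sequence do
well against any prescribed positive weights.

Exchange. If every box is searched forever, the payoff is a sum over pairs of searches: the earlier
one delays a detection at the later one. The set of searches `(i, m)` is the same for all such
sequences, so only the order within each pair is free. A Gittins sequence against a positive `p`
takes the cheaper order in every pair at once (`IsGittins.hiderPayoff_le`).

Perturbation. Let `p` maximize `finiteGuarantee`, with maximum `v`, and let `w` be a positive hiding
strategy. A Gittins sequence against `(1 - ε) p + ε w` costs at most `v` there and at least `v`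
against `p`, hence at most `v` against `w`. As `ε → 0`, compactness of the sequence space gives a
Gittins sequence against `p` itself with the same bound. A uniform `w` then forces `p` to be
positive.

Conclusion. The time vectors of Gittins sequences against `p` form a compact subset of the
hyperplane `∑ p i * x i = v`. If the constant vector `v` were outside their convex hull, a
separating functional, made positive by adding a multiple of `p`, would be a `w` contradicting the
perturbation bound. So some mixture takes time exactly `v` in every box. Carathéodory inside the
hyperplane needs at most `n` sequences, and weak duality identifies `v` with both values. -/

lemma searchCount_eq_count {n : ℕ} (ξ : SearchSeq n) (k : ℕ) (i : Fin n) :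
    searchCount ξ k i = Nat.count (fun j => ξ j = i) k := by
  rw [searchCount, Nat.count_eq_card_filter_range]

lemma searchCount_succ {n : ℕ} (ξ : SearchSeq n) (k : ℕ) (i : Fin n) :
    searchCount ξ (k + 1) i = searchCount ξ k i + if ξ k = i then 1 else 0 := by
  simp only [searchCount_eq_count, Nat.count_succ]

lemma searchCount_mono {n : ℕ} (ξ : SearchSeq n) (i : Fin n) :
    Monotone fun k => searchCount ξ k i := by
  simp only [searchCount_eq_count]
  exact Nat.count_monotone _

lemma searchCount_congr {n : ℕ} {ξ ξ' : SearchSeq n} {k : ℕ} (h : ∀ j < k, ξ j = ξ' j)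
    (i : Fin n) : searchCount ξ k i = searchCount ξ' k i := by
  unfold searchCount
  congr 1
  refine Finset.filter_congr fun j hj => ?_
  rw [h j (Finset.mem_range.1 hj)]

lemma searchCount_lt_of_lt {n : ℕ} (ξ : SearchSeq n) {k l : ℕ} (h : k < l) :
    searchCount ξ k (ξ k) < searchCount ξ l (ξ k) := by
  have h1 := searchCount_mono ξ (ξ k) (Nat.succ_le_of_lt h)
  have h2 := searchCount_succ ξ k (ξ k)
  simp only [if_true] at h2
  simp only [Nat.succ_eq_add_one] at h1
  omega

/-- Every box is searched infinitely often. -/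
def SearchesForever {n : ℕ} (ξ : SearchSeq n) : Prop :=
  ∀ i, {k | ξ k = i}.Infinite

/-! ### Telescoping sums in `ℝ≥0∞` -/

/-- A decreasing sequence equals the sum of its later decrements plus its limit. -/
lemma eq_tsum_add_iInf {a d : ℕ → ℝ≥0∞} (h : ∀ k, a k = a (k + 1) + d k) (j : ℕ) :
    a j = (∑' k, if j ≤ k then d k else 0) + ⨅ k, a k := by
  have hanti : Antitone a := antitone_nat_of_succ_le fun k => by rw [h k]; exact le_self_add
  have hsum : ∀ N, j ≤ N → (∑ k ∈ Finset.range N, if j ≤ k then d k else 0) + a N = a j := by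
    intro N hN
    induction N, hN using Nat.le_induction with
    | base =>
      rw [Finset.sum_eq_zero, zero_add]
      intro k hk
      rw [if_neg (by simpa using hk)]
    | succ N hN ih =>
      rw [Finset.sum_range_succ, if_pos hN, ← ih, h N]
      ring
  have h1 := (ENNReal.tendsto_nat_tsum fun k => if j ≤ k then d k else 0).add
    (tendsto_atTop_iInf hanti)
  refine tendsto_nhds_unique (Tendsto.congr' ?_ tendsto_const_nhds) h1
  filter_upwards [eventually_ge_atTop j] with N hN
  exact (hsum N hN).symm

lemma ofReal_pow_eq_tsum {x : ℝ} (h0 : 0 < x) (h1 : x < 1) (m : ℕ) :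
    ENNReal.ofReal ((1 - x) ^ m) =
      ∑' j, if m ≤ j then ENNReal.ofReal ((1 - x) ^ j * x) else 0 := by
  have hx : 0 < 1 - x := by linarith
  have h := eq_tsum_add_iInf (a := fun j => ENNReal.ofReal ((1 - x) ^ j))
    (d := fun j => ENNReal.ofReal ((1 - x) ^ j * x)) (fun k => by
      rw [← ENNReal.ofReal_add (by positivity) (by positivity)]
      congr 1
      ring) m
  have h2 : ⨅ j, ENNReal.ofReal ((1 - x) ^ j) = 0 := by
    have h3 := ENNReal.tendsto_ofReal
      (tendsto_pow_atTop_nhds_zero_of_lt_one hx.le (by linarith : 1 - x < 1))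
    rw [ENNReal.ofReal_zero] at h3
    refine tendsto_nhds_unique (tendsto_atTop_iInf ?_) h3
    intro a b hab
    exact ENNReal.ofReal_le_ofReal (pow_le_pow_of_le_one hx.le (by linarith) hab)
  simpa [h2] using h

/-! ### Expected times as sums of survival probabilities -/

lemma exists_pos_le {n : ℕ} {t : Fin n → ℝ} (ht : ∀ i, 0 < t i) : ∃ c > 0, ∀ i, c ≤ t i := by
  cases isEmpty_or_nonempty (Fin n) with
  | inl h => exact ⟨1, one_pos, fun i => isEmptyElim i⟩
  | inr h =>
    obtain ⟨i, hi⟩ := Finite.exists_min t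
    exact ⟨t i, ht i, hi⟩

lemma tsum_searchTime_eq_top {n : ℕ} {t : Fin n → ℝ} (ht : ∀ i, 0 < t i) (ξ : SearchSeq n) :
    ∑' k, ENNReal.ofReal (t (ξ k)) = ⊤ := by
  obtain ⟨c, hc, hct⟩ := exists_pos_le ht
  rw [eq_top_iff]
  calc ⊤ = ∑' _ : ℕ, ENNReal.ofReal c :=
        (ENNReal.tsum_const_eq_top_of_ne_zero (by simpa using hc)).symm
    _ ≤ _ := ENNReal.tsum_le_tsum fun k => ENNReal.ofReal_le_ofReal (hct _)

/-- Search `j` is paid for exactly when the hider has survived the searches before it. This form has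
no separate infinite term and makes every summand depend on finitely many searches. -/
lemma expectedTime_eq_tsum {n : ℕ} {t q : Fin n → ℝ} (ht : ∀ i, 0 < t i)
    (hq : ∀ i, 0 < q i ∧ q i < 1) (ξ : SearchSeq n) (i : Fin n) :
    expectedTime t q ξ i = ∑' k, ENNReal.ofReal (t (ξ k)) * survivalProb q ξ i k := by
  have hqi : 0 < 1 - q i := by linarith [(hq i).2]
  have hstep : ∀ k, survivalProb q ξ i k = survivalProb q ξ i (k + 1) + detectionProb q ξ i k := by
    intro k
    unfold detectionProb survivalProb
    rw [searchCount_succ]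
    split_ifs with h
    · rw [← ENNReal.ofReal_mul (by positivity),
        ← ENNReal.ofReal_add (by positivity) (mul_nonneg (by positivity) (hq i).1.le)]
      congr 1
      ring
    · simp
  have hsurv := eq_tsum_add_iInf hstep
  have helapsed : ∀ k, ENNReal.ofReal (elapsedTime t ξ (k + 1)) =
      ∑' j, if j ≤ k then ENNReal.ofReal (t (ξ j)) else 0 := by
    intro k
    rw [elapsedTime, ENNReal.ofReal_sum_of_nonneg fun j _ => (ht _).le,
      tsum_eq_sum (s := Finset.range (k + 1))]
    · refine Finset.sum_congr rfl fun j hj => ?_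
      rw [if_pos (by simpa [Nat.lt_succ_iff] using hj)]
    · intro j hj
      rw [if_neg (by simpa [Nat.lt_succ_iff] using hj)]
  calc expectedTime t q ξ i
      = (∑' k, ∑' j, detectionProb q ξ i k * (if j ≤ k then ENNReal.ofReal (t (ξ j)) else 0)) +
          (∑' j, ENNReal.ofReal (t (ξ j))) * ⨅ k, survivalProb q ξ i k := by
        -- The factor `⊤` is the total time of all searches, so the never-found term can be
        -- distributed over the searches.
        rw [tsum_searchTime_eq_top ht, expectedTime]
        congr 1
        exact tsum_congr fun k => by rw [helapsed, ENNReal.tsum_mul_left]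
    _ = ∑' j, (ENNReal.ofReal (t (ξ j)) * (∑' k, if j ≤ k then detectionProb q ξ i k else 0) +
          ENNReal.ofReal (t (ξ j)) * ⨅ k, survivalProb q ξ i k) := by
        rw [ENNReal.tsum_comm, ENNReal.tsum_add, ENNReal.tsum_mul_right]
        congr 1
        refine tsum_congr fun j => ?_
        rw [← ENNReal.tsum_mul_left]
        refine tsum_congr fun k => ?_
        split_ifs
        · rw [mul_comm]
        · simp
    _ = _ := tsum_congr fun j => by rw [← mul_add, ← hsurv j]

/-- A box searched finitely often keeps its survival probability bounded below, while the total
search time diverges. -/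
lemma searchesForever_of_expectedTime_ne_top {n : ℕ} {t q : Fin n → ℝ} (ht : ∀ i, 0 < t i)
    (hq : ∀ i, 0 < q i ∧ q i < 1) {ξ : SearchSeq n} (h : ∀ i, expectedTime t q ξ i ≠ ⊤) :
    SearchesForever ξ := by
  intro i hfin
  apply h i
  have hqi : 0 < 1 - q i := by linarith [(hq i).2]
  rw [expectedTime_eq_tsum ht hq, eq_top_iff]
  have hle : ∀ k, searchCount ξ k i ≤ hfin.toFinset.card := fun k =>
    Finset.card_le_card fun j hj => by simpa using (Finset.mem_filter.1 hj).2
  calc ⊤ = (∑' k, ENNReal.ofReal (t (ξ k))) *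
        ENNReal.ofReal ((1 - q i) ^ hfin.toFinset.card) := by
        rw [tsum_searchTime_eq_top ht, ENNReal.top_mul]
        simpa using pow_pos hqi _
    _ ≤ _ := by
      rw [← ENNReal.tsum_mul_right]
      refine ENNReal.tsum_le_tsum fun k => ?_
      gcongr
      exact ENNReal.ofReal_le_ofReal
        (pow_le_pow_of_le_one hqi.le (by linarith [(hq i).1]) (hle k))

/-- Each term of the survival series depends on the first `k + 1` boxes only, so it is locally
constant in the product topology; sums of nonnegative continuous terms are lower semicontinuous. -/
lemma lowerSemicontinuous_expectedTime {n : ℕ} {t q : Fin n → ℝ} (ht : ∀ i, 0 < t i)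
    (hq : ∀ i, 0 < q i ∧ q i < 1) (i : Fin n) :
    LowerSemicontinuous fun ξ : SearchSeq n => expectedTime t q ξ i := by
  simp only [expectedTime_eq_tsum ht hq]
  refine lowerSemicontinuous_tsum fun k => Continuous.lowerSemicontinuous ?_
  refine IsLocallyConstant.continuous ((IsLocallyConstant.iff_eventually_eq _).2 fun ξ => ?_)
  have hnear : ∀ᶠ ξ' : SearchSeq n in 𝓝 ξ, ∀ j ∈ Finset.range (k + 1), ξ' j = ξ j := by
    rw [Finset.eventually_all]
    intro j _
    exact (continuous_apply j).tendsto ξ (by simp : {ξ j} ∈ 𝓝 (ξ j))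
  filter_upwards [hnear] with ξ' h
  have h' : ∀ j < k, ξ' j = ξ j := fun j hj => h j (by simp; omega)
  rw [h k (by simp), survivalProb, survivalProb, searchCount_congr h']

/-! ### The round-robin sequence -/

lemma exists_forall_expectedTime_ne_top {n : ℕ} (hn : 1 ≤ n) {t q : Fin n → ℝ}
    (ht : ∀ i, 0 < t i) (hq : ∀ i, 0 < q i ∧ q i < 1) :
    ∃ ξ : SearchSeq n, ∀ i, expectedTime t q ξ i ≠ ⊤ := by
  have : NeZero n := ⟨by omega⟩
  refine ⟨fun k => Fin.ofNat n k, fun i => ?_⟩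
  have hqi : 0 < 1 - q i := by linarith [(hq i).2]
  obtain ⟨j, hj⟩ := Finite.exists_max t
  have hcount : ∀ k, k / n ≤ searchCount (fun k => Fin.ofNat n k) k i := by
    intro k
    rw [searchCount, ← Finset.card_range (k / n)]
    refine Finset.card_le_card_of_injOn (fun m => n * m + i) ?_ ?_
    · intro m hm
      have hm' : m < k / n := by simpa using hm
      have hlt : n * (m + 1) ≤ k := by
        calc n * (m + 1) ≤ n * (k / n) := Nat.mul_le_mul_left _ hm'
          _ ≤ k := Nat.mul_div_le _ _
      have hi := i.2
      rw [mul_add, mul_one] at hlt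
      simp only [Finset.coe_filter, Finset.mem_range, Set.mem_ofPred_eq]
      refine ⟨by omega, ?_⟩
      apply Fin.ext
      simp [Nat.mod_eq_of_lt hi]
    · intro a _ b _ hab
      have hab' : n * a = n * b := by simpa using hab
      exact Nat.eq_of_mul_eq_mul_left (by omega) hab'
  rw [expectedTime_eq_tsum ht hq]
  have hle : ∑' k, ENNReal.ofReal (t ((fun k => Fin.ofNat n k) k)) *
      survivalProb q (fun k => Fin.ofNat n k) i k ≤
      ∑' k, ENNReal.ofReal (t j * (1 - q i) ^ (k / n)) := by
    refine ENNReal.tsum_le_tsum fun k => ?_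
    rw [ENNReal.ofReal_mul (ht j).le, survivalProb]
    exact mul_le_mul' (ENNReal.ofReal_le_ofReal (hj _)) (ENNReal.ofReal_le_ofReal
      (pow_le_pow_of_le_one hqi.le (by linarith [(hq i).1]) (hcount k)))
  refine ne_top_of_le_ne_top ?_ hle
  -- Writing `k = n * m + r` turns the bound into `n` copies of a geometric series.
  have heq : ∑' k, ENNReal.ofReal (t j * (1 - q i) ^ (k / n)) =
      ∑' x : ℕ × Fin n, ENNReal.ofReal (t j * (1 - q i) ^ x.1) := by
    rw [← (Nat.divModEquiv n).tsum_eq]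
    rfl
  rw [heq, ENNReal.tsum_prod (f := fun m _ => ENNReal.ofReal (t j * (1 - q i) ^ m))]
  simp only [ENNReal.tsum_const]
  rw [ENNReal.tsum_mul_left]
  refine ENNReal.mul_ne_top (by simp) ?_
  simp only [ENNReal.ofReal_mul (ht j).le]
  rw [ENNReal.tsum_mul_left]
  refine ENNReal.mul_ne_top ENNReal.ofReal_ne_top ?_
  exact (summable_geometric_of_lt_one hqi.le (by linarith [(hq i).1])).tsum_ofReal_ne_top

/-! ### Optimality of Gittins search sequences -/

lemma gittinsIndex_antitone {n : ℕ} {t q p : Fin n → ℝ} (ht : ∀ i, 0 < t i)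
    (hq : ∀ i, 0 < q i ∧ q i < 1) (hp : ∀ i, 0 ≤ p i) (i : Fin n) :
    Antitone (gittinsIndex t q p i) := by
  intro a b hab
  have h1 : (1 - q i) ^ b ≤ (1 - q i) ^ a :=
    pow_le_pow_of_le_one (by linarith [(hq i).2]) (by linarith [(hq i).1]) hab
  have := hp i
  have := (hq i).1.le
  have := (ht i).le
  unfold gittinsIndex
  gcongr

/-- Some box is searched infinitely often, and its index tends to `0` along its searches. A box
abandoned forever keeps an index bounded below by a positive number and would eventually be
preferred. -/
lemma IsGittins.searchesForever {n : ℕ} {t q p : Fin n → ℝ} (ht : ∀ i, 0 < t i)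
    (hq : ∀ i, 0 < q i ∧ q i < 1) (hp : ∀ i, 0 < p i) {ξ : SearchSeq n}
    (h : IsGittins t q p ξ) : SearchesForever ξ := by
  intro i hfin
  have hfin' : {k | ξ k = i}.Finite := hfin
  obtain ⟨j, hj⟩ : ∃ j, {k | ξ k = j}.Infinite := by
    obtain ⟨j, hj⟩ := Finite.exists_infinite_fiber ξ
    exact ⟨j, Set.infinite_coe_iff.1 hj⟩
  have hle : ∀ k, searchCount ξ k i ≤ hfin'.toFinset.card := fun k =>
    Finset.card_le_card fun j hj => by simpa using (Finset.mem_filter.1 hj).2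
  have hpos : 0 < gittinsIndex t q p i hfin'.toFinset.card := by
    have := hp i
    have := (hq i).1
    have := ht i
    have : 0 < 1 - q i := by linarith [(hq i).2]
    unfold gittinsIndex
    positivity
  have htend : Tendsto (gittinsIndex t q p j) atTop (𝓝 0) := by
    have h0 := tendsto_pow_atTop_nhds_zero_of_lt_one
      (by linarith [(hq j).2] : 0 ≤ 1 - q j) (by linarith [(hq j).1])
    have h1 := ((h0.const_mul (p j)).mul_const (q j)).div_const (t j)
    simp only [mul_zero, zero_mul, zero_div] at h1
    exact h1
  obtain ⟨m, hm⟩ := (htend.eventually (gt_mem_nhds hpos)).exists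
  have hk1 : ξ (Nat.nth (fun k => ξ k = j) m) = j := Nat.nth_mem_of_infinite hj m
  have hk2 : searchCount ξ (Nat.nth (fun k => ξ k = j) m) j = m := by
    rw [searchCount_eq_count]
    exact Nat.count_nth_of_infinite hj m
  have h1 := h (Nat.nth (fun k => ξ k = j) m) i
  rw [hk1, hk2] at h1
  have h2 := gittinsIndex_antitone ht hq (fun i => (hp i).le) i
    (hle (Nat.nth (fun k => ξ k = j) m))
  linarith

/-- A sequence that searches every box infinitely often enumerates the pairs `(i, m)`, the pair
`(i, m)` standing for the search of box `i` that follows `m` earlier searches of that box. -/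
noncomputable def SearchesForever.equiv {n : ℕ} {ξ : SearchSeq n} (h : SearchesForever ξ) :
    ℕ ≃ Fin n × ℕ :=
  Equiv.ofBijective (fun k => (ξ k, searchCount ξ k (ξ k))) <| by
    constructor
    · intro k l hkl
      simp only [Prod.mk.injEq] at hkl
      rcases lt_trichotomy k l with hlt | heq | hlt
      · have := searchCount_lt_of_lt ξ hlt
        rw [hkl.2, hkl.1] at this
        exact absurd this (lt_irrefl _)
      · exact heq
      · have := searchCount_lt_of_lt ξ hlt
        rw [← hkl.2, ← hkl.1] at this
        exact absurd this (lt_irrefl _)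
    · rintro ⟨i, m⟩
      have h1 : ξ (Nat.nth (fun k => ξ k = i) m) = i := Nat.nth_mem_of_infinite (h i) m
      refine ⟨Nat.nth (fun k => ξ k = i) m, ?_⟩
      simp only [h1, searchCount_eq_count, Nat.count_nth_of_infinite (h i) m]

@[simp]
lemma SearchesForever.equiv_apply {n : ℕ} {ξ : SearchSeq n} (h : SearchesForever ξ) (k : ℕ) :
    h.equiv k = (ξ k, searchCount ξ k (ξ k)) := rfl

/-- The probability that search number `a.2` of box `a.1` finds the hider. -/
noncomputable def searchWeight {n : ℕ} (q p : Fin n → ℝ) (a : Fin n × ℕ) : ℝ≥0∞ :=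
  ENNReal.ofReal (p a.1 * ((1 - q a.1) ^ a.2 * q a.1))

/-- The least possible contribution of the pair of searches `a`, `b` to the expected time. -/
noncomputable def pairCost {n : ℕ} (t q p : Fin n → ℝ) (a b : Fin n × ℕ) : ℝ≥0∞ :=
  if a = b then 2 * (ENNReal.ofReal (t a.1) * searchWeight q p a)
  else min (ENNReal.ofReal (t a.1) * searchWeight q p b)
    (ENNReal.ofReal (t b.1) * searchWeight q p a)

/-- The delay that search `k` causes for a detection at search `l`, weighted by the probability
of that detection. -/
noncomputable def delay {n : ℕ} (t q p : Fin n → ℝ) (ξ : SearchSeq n) (k l : ℕ) : ℝ≥0∞ :=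
  if k ≤ l then ENNReal.ofReal (t (ξ k)) * searchWeight q p (ξ l, searchCount ξ l (ξ l)) else 0

lemma hiderPayoff_eq_tsum_delay {n : ℕ} {t q p : Fin n → ℝ} (ht : ∀ i, 0 < t i)
    (hq : ∀ i, 0 < q i ∧ q i < 1) (hp : ∀ i, 0 ≤ p i) {ξ : SearchSeq n}
    (h : SearchesForever ξ) : hiderPayoff t q p ξ = ∑' k, ∑' l, delay t q p ξ k l := by
  -- Among searches of the box `ξ l`, comparing search counts is the same as comparing times; this
  -- translates tails in `m` into tails in `l`.
  have hiff : ∀ k l, searchCount ξ k (ξ l) ≤ searchCount ξ l (ξ l) ↔ k ≤ l := fun k l =>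
    ⟨fun hc => not_lt.1 fun hlt => absurd (searchCount_lt_of_lt ξ hlt) (not_lt.2 hc),
      fun hkl => searchCount_mono ξ _ hkl⟩
  have hterm : ∀ k, ∑ i, ENNReal.ofReal (p i) * survivalProb q ξ i k =
      ∑' l, if k ≤ l then searchWeight q p (ξ l, searchCount ξ l (ξ l)) else 0 := by
    intro k
    calc ∑ i, ENNReal.ofReal (p i) * survivalProb q ξ i k
        = ∑' i, ∑' m, if searchCount ξ k i ≤ m then searchWeight q p (i, m) else 0 := by
          rw [tsum_fintype]
          refine Finset.sum_congr rfl fun i _ => ?_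
          rw [survivalProb, ofReal_pow_eq_tsum (hq i).1 (hq i).2, ← ENNReal.tsum_mul_left]
          refine tsum_congr fun m => ?_
          rw [mul_ite, mul_zero, searchWeight, ENNReal.ofReal_mul (hp i)]
      _ = ∑' a : Fin n × ℕ, if searchCount ξ k a.1 ≤ a.2 then searchWeight q p a else 0 :=
          ENNReal.tsum_prod.symm
      _ = _ := by
          rw [← h.equiv.tsum_eq]
          simp only [h.equiv_apply, hiff]
  calc hiderPayoff t q p ξ
      = ∑ i, ∑' k, ENNReal.ofReal (t (ξ k)) * (ENNReal.ofReal (p i) * survivalProb q ξ i k) := by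
        unfold hiderPayoff
        refine Finset.sum_congr rfl fun i _ => ?_
        rw [expectedTime_eq_tsum ht hq, ← ENNReal.tsum_mul_left]
        exact tsum_congr fun k => mul_left_comm _ _ _
    _ = ∑' k, ENNReal.ofReal (t (ξ k)) * ∑ i, ENNReal.ofReal (p i) * survivalProb q ξ i k := by
        rw [← Summable.tsum_finsetSum fun _ _ => ENNReal.summable]
        simp only [Finset.mul_sum]
    _ = _ := by
        refine tsum_congr fun k => ?_
        rw [hterm, ← ENNReal.tsum_mul_left]
        refine tsum_congr fun l => ?_
        rw [mul_ite, mul_zero, delay]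

/-- Doubling symmetrizes the sum, so each term concerns a pair of searches regardless of order. A
diagonal pair then counts twice, whence the factor `2` in `pairCost`. -/
lemma two_mul_hiderPayoff {n : ℕ} {t q p : Fin n → ℝ} (ht : ∀ i, 0 < t i)
    (hq : ∀ i, 0 < q i ∧ q i < 1) (hp : ∀ i, 0 ≤ p i) {ξ : SearchSeq n}
    (h : SearchesForever ξ) :
    2 * hiderPayoff t q p ξ = ∑' k, ∑' l, (delay t q p ξ k l + delay t q p ξ l k) := by
  simp only [ENNReal.tsum_add]
  rw [ENNReal.tsum_comm (f := fun k l => delay t q p ξ l k),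
    ← hiderPayoff_eq_tsum_delay ht hq hp h, two_mul]

/-- The left side does not mention `ξ`: this is the common lower bound for all sequences that search
every box forever. -/
lemma tsum_pairCost_eq {n : ℕ} (t q p : Fin n → ℝ) {ξ : SearchSeq n} (h : SearchesForever ξ) :
    ∑' a, ∑' b, pairCost t q p a b =
      ∑' k, ∑' l, pairCost t q p (ξ k, searchCount ξ k (ξ k)) (ξ l, searchCount ξ l (ξ l)) := by
  rw [← h.equiv.tsum_eq]
  exact tsum_congr fun k => (h.equiv.tsum_eq _).symm

lemma tsum_pairCost_le {n : ℕ} {t q p : Fin n → ℝ} (ht : ∀ i, 0 < t i)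
    (hq : ∀ i, 0 < q i ∧ q i < 1) (hp : ∀ i, 0 ≤ p i) {ξ : SearchSeq n}
    (h : SearchesForever ξ) :
    ∑' a, ∑' b, pairCost t q p a b ≤ 2 * hiderPayoff t q p ξ := by
  rw [two_mul_hiderPayoff ht hq hp h, tsum_pairCost_eq t q p h]
  refine ENNReal.tsum_le_tsum fun k => ENNReal.tsum_le_tsum fun l => ?_
  unfold pairCost delay
  have hinj : ((ξ k, searchCount ξ k (ξ k)) = (ξ l, searchCount ξ l (ξ l))) ↔ k = l :=
    h.equiv.injective.eq_iff
  simp only [hinj]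
  rcases lt_trichotomy k l with hlt | rfl | hlt
  · rw [if_neg hlt.ne, if_pos hlt.le, if_neg (not_le.2 hlt), add_zero]
    exact min_le_left _ _
  · simp [two_mul]
  · rw [if_neg hlt.ne', if_pos hlt.le, if_neg (not_le.2 hlt), zero_add]
    exact min_le_right _ _

/-- At time `k` the index of `ξ k` is at least that of `ξ l`, whose index can only fall by time `l`.
Clearing denominators says that the order chosen is the cheaper one. -/
lemma IsGittins.mul_searchWeight_le {n : ℕ} {t q p : Fin n → ℝ} (ht : ∀ i, 0 < t i)
    (hq : ∀ i, 0 < q i ∧ q i < 1) (hp : ∀ i, 0 ≤ p i) {ξ : SearchSeq n}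
    (hξ : IsGittins t q p ξ) {k l : ℕ} (hkl : k ≤ l) :
    ENNReal.ofReal (t (ξ k)) * searchWeight q p (ξ l, searchCount ξ l (ξ l)) ≤
      ENNReal.ofReal (t (ξ l)) * searchWeight q p (ξ k, searchCount ξ k (ξ k)) := by
  have h1 := (gittinsIndex_antitone ht hq hp (ξ l) (searchCount_mono ξ (ξ l) hkl)).trans
    (hξ k (ξ l))
  unfold gittinsIndex at h1
  rw [div_le_div_iff₀ (ht _) (ht _)] at h1
  unfold searchWeight
  rw [← ENNReal.ofReal_mul (ht _).le, ← ENNReal.ofReal_mul (ht _).le]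
  refine ENNReal.ofReal_le_ofReal ?_
  linarith

lemma IsGittins.two_mul_hiderPayoff_le {n : ℕ} {t q p : Fin n → ℝ} (ht : ∀ i, 0 < t i)
    (hq : ∀ i, 0 < q i ∧ q i < 1) (hp : ∀ i, 0 < p i) {ξ : SearchSeq n}
    (hξ : IsGittins t q p ξ) :
    2 * hiderPayoff t q p ξ ≤ ∑' a, ∑' b, pairCost t q p a b := by
  have h := hξ.searchesForever ht hq hp
  have hp' : ∀ i, 0 ≤ p i := fun i => (hp i).le
  rw [two_mul_hiderPayoff ht hq hp' h, tsum_pairCost_eq t q p h]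
  refine ENNReal.tsum_le_tsum fun k => ENNReal.tsum_le_tsum fun l => ?_
  unfold pairCost delay
  have hinj : ((ξ k, searchCount ξ k (ξ k)) = (ξ l, searchCount ξ l (ξ l))) ↔ k = l :=
    h.equiv.injective.eq_iff
  simp only [hinj]
  rcases lt_trichotomy k l with hlt | rfl | hlt
  · rw [if_neg hlt.ne, if_pos hlt.le, if_neg (not_le.2 hlt), add_zero]
    exact le_min le_rfl (hξ.mul_searchWeight_le ht hq hp' hlt.le)
  · simp [two_mul]
  · rw [if_neg hlt.ne', if_pos hlt.le, if_neg (not_le.2 hlt), zero_add]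
    exact le_min (hξ.mul_searchWeight_le ht hq hp' hlt.le) le_rfl

lemma hiderPayoff_ne_top_iff {n : ℕ} {t q p : Fin n → ℝ} (hp : ∀ i, 0 < p i)
    {ξ : SearchSeq n} : hiderPayoff t q p ξ ≠ ⊤ ↔ ∀ i, expectedTime t q ξ i ≠ ⊤ := by
  unfold hiderPayoff
  constructor
  · intro h i hi
    refine h (ENNReal.sum_eq_top.2 ⟨i, Finset.mem_univ i, ?_⟩)
    rw [hi, ENNReal.mul_top]
    simpa using hp i
  · intro h
    exact ENNReal.sum_ne_top.2 fun i _ => ENNReal.mul_ne_top ENNReal.ofReal_ne_top (h i)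

/-- Against a hiding strategy that gives every box positive probability, Gittins search
sequences are best responses. -/
lemma IsGittins.hiderPayoff_le {n : ℕ} {t q p : Fin n → ℝ} (ht : ∀ i, 0 < t i)
    (hq : ∀ i, 0 < q i ∧ q i < 1) (hp : ∀ i, 0 < p i) {ξ : SearchSeq n}
    (hξ : IsGittins t q p ξ) (ξ' : SearchSeq n) :
    hiderPayoff t q p ξ ≤ hiderPayoff t q p ξ' := by
  by_cases htop : hiderPayoff t q p ξ' = ⊤
  · rw [htop]
    exact le_top
  have h' := searchesForever_of_expectedTime_ne_top ht hq ((hiderPayoff_ne_top_iff hp).1 htop)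
  have h2 := (hξ.two_mul_hiderPayoff_le ht hq hp).trans
    (tsum_pairCost_le ht hq (fun i => (hp i).le) h')
  exact (ENNReal.mul_le_mul_iff_right (by norm_num) (by norm_num)).1 h2

lemma IsGittins.hiderPayoff_eq {n : ℕ} {t q p : Fin n → ℝ} (ht : ∀ i, 0 < t i)
    (hq : ∀ i, 0 < q i ∧ q i < 1) (hp : ∀ i, 0 < p i) {ξ : SearchSeq n}
    (hξ : IsGittins t q p ξ) : hiderPayoff t q p ξ = hiderGuarantee t q p :=
  le_antisymm (le_iInf fun ξ' => hξ.hiderPayoff_le ht hq hp ξ') (iInf_le _ _)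

lemma IsGittins.expectedTime_ne_top {n : ℕ} (hn : 1 ≤ n) {t q p : Fin n → ℝ}
    (ht : ∀ i, 0 < t i) (hq : ∀ i, 0 < q i ∧ q i < 1) (hp : ∀ i, 0 < p i) {ξ : SearchSeq n}
    (hξ : IsGittins t q p ξ) (i : Fin n) : expectedTime t q ξ i ≠ ⊤ := by
  obtain ⟨ξ', hξ'⟩ := exists_forall_expectedTime_ne_top hn ht hq
  exact (hiderPayoff_ne_top_iff hp).1 (ne_top_of_le_ne_top ((hiderPayoff_ne_top_iff hp).2 hξ')
    (hξ.hiderPayoff_le ht hq hp ξ')) i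

/-! ### Existence and closedness of Gittins search sequences -/

/-- The search counts produced by searching box `f c` whenever the current counts are `c`. -/
def feedbackCounts {n : ℕ} (f : (Fin n → ℕ) → Fin n) : ℕ → Fin n → ℕ
  | 0 => 0
  | k + 1 => feedbackCounts f k + Pi.single (f (feedbackCounts f k)) 1

lemma exists_isGittins {n : ℕ} (hn : 1 ≤ n) (t q p : Fin n → ℝ) : ∃ ξ, IsGittins t q p ξ := by
  have : NeZero n := ⟨by omega⟩
  choose f hf using fun c : Fin n → ℕ => Finite.exists_max fun i => gittinsIndex t q p i (c i)
  have hcount : ∀ k i, searchCount (fun k => f (feedbackCounts f k)) k i =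
      feedbackCounts f k i := by
    intro k i
    induction k with
    | zero => simp [searchCount, feedbackCounts]
    | succ k ih =>
      rw [searchCount_succ, ih, feedbackCounts, Pi.add_apply, Pi.single_apply]
      simp only [eq_comm]
  refine ⟨fun k => f (feedbackCounts f k), fun k i => ?_⟩
  rw [hcount, hcount]
  exact hf _ i

/-- The condition at stage `k` involves only the first `k + 1` boxes, which are eventually constant,
and indices continuous in `p`. Hence the weak inequality survives the limit. -/
lemma IsGittins.of_tendsto {n : ℕ} {t q : Fin n → ℝ} {α : Type*} {l : Filter α} [l.NeBot]
    {P : α → Fin n → ℝ} {X : α → SearchSeq n} {p : Fin n → ℝ} {ξ : SearchSeq n}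
    (hP : Tendsto P l (𝓝 p)) (hX : Tendsto X l (𝓝 ξ)) (h : ∀ a, IsGittins t q (P a) (X a)) :
    IsGittins t q p ξ := by
  intro k i
  have hlim : ∀ j m, Tendsto (fun a => gittinsIndex t q (P a) j m) l
      (𝓝 (gittinsIndex t q p j m)) := fun j m =>
    ((((tendsto_pi_nhds.1 hP j).mul_const _).mul_const _).div_const _)
  refine le_of_tendsto_of_tendsto (hlim _ _) (hlim _ _) ?_
  have hnear : ∀ᶠ a in l, ∀ j ∈ Finset.range (k + 1), X a j = ξ j := by
    rw [Finset.eventually_all]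
    intro j _
    exact (tendsto_pi_nhds.1 hX j) (by simp : {ξ j} ∈ 𝓝 (ξ j))
  filter_upwards [hnear] with a ha
  have ha' : ∀ j < k, X a j = ξ j := fun j hj => ha j (by simp; omega)
  have h1 := h a k i
  rwa [ha k (by simp), searchCount_congr ha', searchCount_congr ha'] at h1

lemma isCompact_setOf_isGittins {n : ℕ} (t q p : Fin n → ℝ) :
    IsCompact {ξ : SearchSeq n | IsGittins t q p ξ} := by
  refine IsClosed.isCompact (isClosed_of_closure_subset fun ξ hξ => ?_)
  obtain ⟨X, hX, hlim⟩ := mem_closure_iff_seq_limit.1 hξ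
  exact IsGittins.of_tendsto tendsto_const_nhds hlim hX

/-! ### Optimal hiding strategies -/

/-- The expected time guaranteed by `p` against search sequences with finite expected times in
all boxes. Unlike `hiderGuarantee`, it is visibly upper semicontinuous in `p`. -/
noncomputable def finiteGuarantee {n : ℕ} (t q p : Fin n → ℝ) : ℝ≥0∞ :=
  ⨅ ξ ∈ {ξ : SearchSeq n | ∀ i, expectedTime t q ξ i ≠ ⊤}, hiderPayoff t q p ξ

lemma hiderGuarantee_le_finiteGuarantee {n : ℕ} (t q p : Fin n → ℝ) :
    hiderGuarantee t q p ≤ finiteGuarantee t q p :=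
  le_iInf fun ξ => le_iInf fun _ => iInf_le _ ξ

lemma finiteGuarantee_le {n : ℕ} {t q : Fin n → ℝ} (p : Fin n → ℝ) {ξ : SearchSeq n}
    (h : ∀ i, expectedTime t q ξ i ≠ ⊤) : finiteGuarantee t q p ≤ hiderPayoff t q p ξ :=
  iInf₂_le ξ h

lemma finiteGuarantee_ne_top {n : ℕ} (hn : 1 ≤ n) {t q : Fin n → ℝ} (ht : ∀ i, 0 < t i)
    (hq : ∀ i, 0 < q i ∧ q i < 1) (p : Fin n → ℝ) : finiteGuarantee t q p ≠ ⊤ := by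
  obtain ⟨ξ, hξ⟩ := exists_forall_expectedTime_ne_top hn ht hq
  refine ne_top_of_le_ne_top ?_ (finiteGuarantee_le p hξ)
  exact ENNReal.sum_ne_top.2 fun i _ => ENNReal.mul_ne_top ENNReal.ofReal_ne_top (hξ i)

/-- For positive `p` the unrestricted infimum is attained by a Gittins sequence, which has finite
times. -/
lemma finiteGuarantee_eq_hiderGuarantee {n : ℕ} (hn : 1 ≤ n) {t q p : Fin n → ℝ}
    (ht : ∀ i, 0 < t i) (hq : ∀ i, 0 < q i ∧ q i < 1) (hp : ∀ i, 0 < p i) :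
    finiteGuarantee t q p = hiderGuarantee t q p := by
  refine le_antisymm ?_ (hiderGuarantee_le_finiteGuarantee t q p)
  obtain ⟨ξ, hξ⟩ := exists_isGittins hn t q p
  rw [← hξ.hiderPayoff_eq ht hq hp]
  exact finiteGuarantee_le p (hξ.expectedTime_ne_top hn ht hq hp)

lemma upperSemicontinuous_finiteGuarantee {n : ℕ} (t q : Fin n → ℝ) :
    UpperSemicontinuous (finiteGuarantee t q) := by
  refine upperSemicontinuous_biInf fun ξ hξ => Continuous.upperSemicontinuous ?_
  refine continuous_finsetSum _ fun i _ => ?_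
  exact ENNReal.continuous_mul_const (hξ i) |>.comp
    (ENNReal.continuous_ofReal.comp (continuous_apply i))

/-- `p` maximizes the finite guarantee over all mixed hiding strategies. -/
def MaximizesFiniteGuarantee {n : ℕ} (t q p : Fin n → ℝ) : Prop :=
  p ∈ stdSimplex ℝ (Fin n) ∧
    ∀ p' ∈ stdSimplex ℝ (Fin n), finiteGuarantee t q p' ≤ finiteGuarantee t q p

lemma exists_maximizesFiniteGuarantee {n : ℕ} (hn : 1 ≤ n) (t q : Fin n → ℝ) :
    ∃ p, MaximizesFiniteGuarantee t q p := by
  have : NeZero n := ⟨by omega⟩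
  obtain ⟨p, hp, hmax⟩ := UpperSemicontinuousOn.exists_isMaxOn
    (s := stdSimplex ℝ (Fin n)) ⟨_, single_mem_stdSimplex ℝ (0 : Fin n)⟩
    (isCompact_stdSimplex ℝ (Fin n))
    ((upperSemicontinuous_finiteGuarantee t q).upperSemicontinuousOn _)
  exact ⟨p, hp, fun p' hp' => hmax hp'⟩

lemma hiderPayoff_combo {n : ℕ} (t q : Fin n → ℝ) {p w : Fin n → ℝ} (hp : ∀ i, 0 ≤ p i)
    (hw : ∀ i, 0 ≤ w i) {a b : ℝ} (ha : 0 ≤ a) (hb : 0 ≤ b) (ξ : SearchSeq n) :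
    hiderPayoff t q (a • p + b • w) ξ =
      ENNReal.ofReal a * hiderPayoff t q p ξ + ENNReal.ofReal b * hiderPayoff t q w ξ := by
  unfold hiderPayoff
  rw [Finset.mul_sum, Finset.mul_sum, ← Finset.sum_add_distrib]
  refine Finset.sum_congr rfl fun i _ => ?_
  simp only [Pi.add_apply, Pi.smul_apply, smul_eq_mul]
  rw [ENNReal.ofReal_add (mul_nonneg ha (hp i)) (mul_nonneg hb (hw i)), ENNReal.ofReal_mul ha,
    ENNReal.ofReal_mul hb]
  ring

lemma lowerSemicontinuous_const_mul_expectedTime {n : ℕ} {t q : Fin n → ℝ} (ht : ∀ i, 0 < t i)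
    (hq : ∀ i, 0 < q i ∧ q i < 1) (c : ℝ) (i : Fin n) :
    LowerSemicontinuous fun ξ : SearchSeq n => ENNReal.ofReal c * expectedTime t q ξ i :=
  (ENNReal.continuous_const_mul ENNReal.ofReal_ne_top).comp_lowerSemicontinuous
    (lowerSemicontinuous_expectedTime ht hq i) fun _ _ h => mul_le_mul_right h _

lemma lowerSemicontinuous_hiderPayoff {n : ℕ} {t q : Fin n → ℝ} (ht : ∀ i, 0 < t i)
    (hq : ∀ i, 0 < q i ∧ q i < 1) (p : Fin n → ℝ) :
    LowerSemicontinuous fun ξ : SearchSeq n => hiderPayoff t q p ξ :=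
  lowerSemicontinuous_sum fun i _ => lowerSemicontinuous_const_mul_expectedTime ht hq (p i) i

/-- Perturbing a maximizing hiding strategy in the direction of `w` yields a Gittins search
sequence that does well against `w`. -/
lemma MaximizesFiniteGuarantee.exists_isGittins_hiderPayoff_le {n : ℕ} (hn : 1 ≤ n)
    {t q p w : Fin n → ℝ} (ht : ∀ i, 0 < t i) (hq : ∀ i, 0 < q i ∧ q i < 1)
    (hp : MaximizesFiniteGuarantee t q p) (hw : w ∈ stdSimplex ℝ (Fin n))
    (hw' : ∀ i, 0 < w i) :
    ∃ ξ, IsGittins t q p ξ ∧ hiderPayoff t q w ξ ≤ finiteGuarantee t q p := by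
  obtain ⟨⟨hp0, hp1⟩, hmax⟩ := hp
  let ε : ℕ → ℝ := fun m => 1 / ((m : ℝ) + 1 + 1)
  have hε0 : ∀ m, 0 < ε m := fun m => by positivity
  have hε1 : ∀ m, ε m < 1 := fun m => by
    rw [div_lt_one (by positivity)]
    have : (0 : ℝ) ≤ m := m.cast_nonneg
    linarith
  have hεlim : Tendsto ε atTop (𝓝 0) := by
    have h := (tendsto_add_atTop_iff_nat 1).2 (tendsto_one_div_add_atTop_nhds_zero_nat (𝕜 := ℝ))
    simpa [ε] using h
  let P : ℕ → Fin n → ℝ := fun m => (1 - ε m) • p + ε m • w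
  have hPpos : ∀ m i, 0 < P m i := fun m i =>
    add_pos_of_nonneg_of_pos (mul_nonneg (by linarith [hε1 m]) (hp0 i))
      (mul_pos (hε0 m) (hw' i))
  have hPmem : ∀ m, P m ∈ stdSimplex ℝ (Fin n) := fun m =>
    convex_stdSimplex ℝ (Fin n) ⟨hp0, hp1⟩ hw (by linarith [hε1 m]) (hε0 m).le (by ring)
  choose X hX using fun m => exists_isGittins hn t q (P m)
  have hle : ∀ m, hiderPayoff t q w (X m) ≤ finiteGuarantee t q p := by
    intro m
    have hε := hε0 m
    have h1ε : 0 < 1 - ε m := by linarith [hε1 m]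
    have hXfin := (hX m).expectedTime_ne_top hn ht hq (hPpos m)
    have hv := finiteGuarantee_ne_top hn ht hq p
    -- Linearity in the hiding strategy splits the payoff at `P m`; the common first summand is
    -- finite and cancels, leaving the bound against `w`.
    have h1 : ENNReal.ofReal (1 - ε m) * finiteGuarantee t q p +
        ENNReal.ofReal (ε m) * hiderPayoff t q w (X m) ≤
        ENNReal.ofReal (1 - ε m) * finiteGuarantee t q p +
        ENNReal.ofReal (ε m) * finiteGuarantee t q p := by
      calc _ ≤ ENNReal.ofReal (1 - ε m) * hiderPayoff t q p (X m) +
            ENNReal.ofReal (ε m) * hiderPayoff t q w (X m) := by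
            gcongr
            exact finiteGuarantee_le p hXfin
        _ = hiderPayoff t q (P m) (X m) :=
            (hiderPayoff_combo t q hp0 hw.1 h1ε.le hε.le _).symm
        _ = finiteGuarantee t q (P m) := by
            rw [(hX m).hiderPayoff_eq ht hq (hPpos m),
              finiteGuarantee_eq_hiderGuarantee hn ht hq (hPpos m)]
        _ ≤ finiteGuarantee t q p := hmax _ (hPmem m)
        _ = _ := by
            rw [← add_mul, ← ENNReal.ofReal_add h1ε.le hε.le, sub_add_cancel, ENNReal.ofReal_one,
              one_mul]
    have h2 := (ENNReal.add_le_add_iff_left (ENNReal.mul_ne_top ENNReal.ofReal_ne_top hv)).1 h1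
    exact (ENNReal.mul_le_mul_iff_right (by simpa using hε) ENNReal.ofReal_ne_top).1 h2
  obtain ⟨ξ, φ, hφ, hlim⟩ := CompactSpace.tendsto_subseq X
  have hPlim : Tendsto P atTop (𝓝 p) := by
    have h := ((tendsto_const_nhds (x := (1 : ℝ))).sub hεlim).smul_const p |>.add
      (hεlim.smul_const w)
    simpa [P] using h
  refine ⟨ξ, IsGittins.of_tendsto (hPlim.comp hφ.tendsto_atTop) hlim fun m => hX (φ m), ?_⟩
  exact ((lowerSemicontinuous_hiderPayoff ht hq w).isClosed_preimage
    (finiteGuarantee t q p)).mem_of_tendsto hlim (Eventually.of_forall fun m => hle (φ m))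

lemma MaximizesFiniteGuarantee.pos {n : ℕ} (hn : 1 ≤ n) {t q p : Fin n → ℝ}
    (ht : ∀ i, 0 < t i) (hq : ∀ i, 0 < q i ∧ q i < 1) (hp : MaximizesFiniteGuarantee t q p)
    (i : Fin n) : 0 < p i := by
  have hn' : (0 : ℝ) < n := by exact_mod_cast hn
  have hu : ∀ j : Fin n, (0 : ℝ) < (fun _ : Fin n => (n : ℝ)⁻¹) j := fun j => by positivity
  obtain ⟨ξ, hξ, hle⟩ := hp.exists_isGittins_hiderPayoff_le hn ht hq
    (w := fun _ => (n : ℝ)⁻¹) ⟨fun j => (hu j).le, by simp [hn'.ne']⟩ hu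
  have hfin := (hiderPayoff_ne_top_iff hu).1
    (ne_top_of_le_ne_top (finiteGuarantee_ne_top hn ht hq p) hle)
  obtain ⟨k, hk⟩ := (searchesForever_of_expectedTime_ne_top ht hq hfin i).nonempty
  have hk' : ξ k = i := hk
  by_contra hneg
  have hzero : p i = 0 := le_antisymm (not_lt.1 hneg) (hp.1.1 i)
  -- When box `i` is searched its index is `0` and maximal, so no `p j` can be positive,
  -- contradicting total mass `1`.
  have hall : ∀ j, p j ≤ 0 := by
    intro j
    have h1 := hξ k j
    rw [hk', gittinsIndex, gittinsIndex, hzero] at h1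
    simp only [zero_mul, zero_div] at h1
    by_contra hj
    push Not at hj
    have := (hq j).1
    have := ht j
    have : 0 < 1 - q j := by linarith [(hq j).2]
    have h2 : 0 < p j * (1 - q j) ^ searchCount ξ k j * q j / t j := by positivity
    linarith
  have h1 := hp.1.2
  have h2 : ∑ j, p j ≤ 0 := Finset.sum_nonpos fun j _ => hall j
  linarith

lemma MaximizesFiniteGuarantee.lowerValue_eq {n : ℕ} (hn : 1 ≤ n) {t q p : Fin n → ℝ}
    (ht : ∀ i, 0 < t i) (hq : ∀ i, 0 < q i ∧ q i < 1) (hp : MaximizesFiniteGuarantee t q p) :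
    lowerValue t q = finiteGuarantee t q p := by
  refine le_antisymm
    (iSup₂_le fun p' hp' => (hiderGuarantee_le_finiteGuarantee t q p').trans (hp.2 p' hp')) ?_
  rw [finiteGuarantee_eq_hiderGuarantee hn ht hq (hp.pos hn ht hq)]
  exact le_iSup₂ (f := fun p (_ : p ∈ stdSimplex ℝ (Fin n)) => hiderGuarantee t q p) p hp.1

lemma IsOptimalHiding.maximizesFiniteGuarantee {n : ℕ} (hn : 1 ≤ n) {t q p : Fin n → ℝ}
    (ht : ∀ i, 0 < t i) (hq : ∀ i, 0 < q i ∧ q i < 1) (hp : IsOptimalHiding t q p) :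
    MaximizesFiniteGuarantee t q p := by
  obtain ⟨p₀, hp₀⟩ := exists_maximizesFiniteGuarantee hn t q
  refine ⟨hp.1, fun p' hp' => (hp₀.2 p' hp').trans ?_⟩
  rw [← hp₀.lowerValue_eq hn ht hq, ← hp.2]
  exact hiderGuarantee_le_finiteGuarantee t q p

/-! ### Convex hulls -/

/-- Carathéodory bounds the number of points needed by `N`, so the hull is a continuous image of a
simplex times a power of `s`. -/
lemma isCompact_convexHull_of_isCompact {E : Type*} [NormedAddCommGroup E] [NormedSpace ℝ E]
    [FiniteDimensional ℝ E] {s : Set E} (hs : IsCompact s) : IsCompact (convexHull ℝ s) := by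
  obtain rfl | ⟨x₀, hx₀⟩ := s.eq_empty_or_nonempty
  · simp
  let N := Module.finrank ℝ E + 1
  let F : (Fin N → ℝ) × (Fin N → E) → E := fun x => ∑ j, x.1 j • x.2 j
  have himage : convexHull ℝ s = F '' (stdSimplex ℝ (Fin N) ×ˢ Set.univ.pi fun _ => s) := by
    apply Set.Subset.antisymm
    · intro x hx
      obtain ⟨ι, _, z, w, hz, hind, hw0, hw1, hwz⟩ := eq_pos_convex_span_of_mem_convexHull hx
      have hcard : Fintype.card ι ≤ Fintype.card (Fin N) := by
        rw [Fintype.card_fin]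
        exact hind.card_le_finrank_succ.trans (Nat.succ_le_succ (Submodule.finrank_le _))
      obtain ⟨e⟩ := Function.Embedding.nonempty_of_card_le hcard
      have he := e.injective
      have hout : ∀ j, j ∉ Set.range e → Function.extend e w 0 j = 0 := fun j hj =>
        Function.extend_apply' _ _ _ hj
      -- Shorter combinations are padded to length `N` with weight `0` at the dummy point `x₀`.
      refine ⟨(Function.extend e w 0, Function.extend e z fun _ => x₀), ⟨⟨fun j => ?_, ?_⟩, ?_⟩, ?_⟩
      · by_cases hj : j ∈ Set.range e
        · obtain ⟨i, rfl⟩ := hj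
          simpa [he.extend_apply] using (hw0 i).le
        · exact (hout j hj).ge
      · rw [← hw1]
        exact (Fintype.sum_of_injective e he _ _ hout fun i => (he.extend_apply _ _ _).symm).symm
      · intro j _
        by_cases hj : j ∈ Set.range e
        · obtain ⟨i, rfl⟩ := hj
          simpa [he.extend_apply] using hz ⟨i, rfl⟩
        · simpa [Function.extend_apply' _ _ _ hj] using hx₀
      · rw [← hwz]
        refine (Fintype.sum_of_injective e he _ _ (fun j hj => ?_) fun i => ?_).symm
        · simp [hout j hj]
        · simp [he.extend_apply]
    · rintro _ ⟨⟨w, z⟩, ⟨⟨hw0, hw1⟩, hz⟩, rfl⟩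
      exact (convex_convexHull ℝ s).sum_mem (fun j _ => hw0 j) hw1
        fun j _ => subset_convexHull ℝ s (hz j (Set.mem_univ j))
  rw [himage]
  refine ((isCompact_stdSimplex ℝ (Fin N)).prod (isCompact_univ_pi fun _ => hs)).image ?_
  fun_prop

/-- The points lie in a hyperplane, whose direction has dimension below `n`; this saves one point
over Carathéodory in the full space. -/
lemma card_le_of_affineIndependent_of_sum_mul_eq {n : ℕ} {ι : Type*} [Fintype ι]
    {z : ι → Fin n → ℝ} (hz : AffineIndependent ℝ z) {p : Fin n → ℝ} (hp : p ≠ 0) {c : ℝ}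
    (hc : ∀ a, ∑ i, p i * z a i = c) : Fintype.card ι ≤ n := by
  let φ : (Fin n → ℝ) →ₗ[ℝ] ℝ := ∑ i, p i • LinearMap.proj i
  have hφ : ∀ x, φ x = ∑ i, p i * x i := fun x => by simp [φ]
  have hker : vectorSpan ℝ (Set.range z) ≤ LinearMap.ker φ := by
    rw [vectorSpan_def, Submodule.span_le]
    rintro _ ⟨_, ⟨a, rfl⟩, _, ⟨b, rfl⟩, rfl⟩
    beta_reduce
    rw [SetLike.mem_coe, LinearMap.mem_ker, vsub_eq_sub, map_sub, hφ, hφ, hc, hc, sub_self]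
  have hne : LinearMap.ker φ ≠ ⊤ := by
    obtain ⟨i, hi⟩ := Function.ne_iff.1 hp
    intro htop
    have h : φ (Pi.single i 1) = 0 := by
      rw [← LinearMap.mem_ker, htop]
      trivial
    rw [hφ] at h
    simp [Pi.single_apply] at h
    exact hi h
  have h1 := Submodule.finrank_lt hne
  have h2 := Submodule.finrank_mono hker
  have h3 := hz.card_le_finrank_succ
  rw [Module.finrank_fin_fun] at h1
  omega

/-! ### Optimal search strategies -/

lemma hiderGuarantee_le_searcherGuarantee {n : ℕ} (t q : Fin n → ℝ) {p : Fin n → ℝ}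
    (hp : p ∈ stdSimplex ℝ (Fin n)) (η : PMF (SearchSeq n)) :
    hiderGuarantee t q p ≤ searcherGuarantee t q η := by
  calc hiderGuarantee t q p = ∑' ξ, η ξ * hiderGuarantee t q p := by
        rw [ENNReal.tsum_mul_right, η.tsum_coe, one_mul]
    _ ≤ ∑' ξ, η ξ * hiderPayoff t q p ξ :=
        ENNReal.tsum_le_tsum fun ξ => mul_le_mul_right (iInf_le _ ξ) _
    _ = ∑ i, ENNReal.ofReal (p i) * mixedTime t q η i := by
        simp only [hiderPayoff, mixedTime, Finset.mul_sum, ← ENNReal.tsum_mul_left]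
        rw [Summable.tsum_finsetSum fun _ _ => ENNReal.summable]
        exact Finset.sum_congr rfl fun i _ => tsum_congr fun ξ => mul_left_comm _ _ _
    _ ≤ ∑ i, ENNReal.ofReal (p i) * searcherGuarantee t q η :=
        Finset.sum_le_sum fun i _ => mul_le_mul_right (le_iSup (mixedTime t q η) i) _
    _ = searcherGuarantee t q η := by
        rw [← Finset.sum_mul, ← ENNReal.ofReal_sum_of_nonneg fun i _ => hp.1 i, hp.2,
          ENNReal.ofReal_one, one_mul]

lemma mixedTime_map {n : ℕ} (t q : Fin n → ℝ) {ι : Type*} (μ : PMF ι) (X : ι → SearchSeq n)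
    (i : Fin n) : mixedTime t q (μ.map X) i = ∑' a, μ a * expectedTime t q (X a) i := by
  unfold mixedTime
  simp only [PMF.map_apply, ← ENNReal.tsum_mul_right]
  rw [ENNReal.tsum_comm]
  refine tsum_congr fun a => ?_
  rw [tsum_eq_single (X a) fun ξ hξ => by rw [if_neg hξ, zero_mul], if_pos rfl]

/-- The vector of expected times in the `n` boxes, as real numbers. -/
noncomputable def timeVector {n : ℕ} (t q : Fin n → ℝ) (ξ : SearchSeq n) : Fin n → ℝ :=
  fun i => (expectedTime t q ξ i).toReal

lemma toReal_hiderPayoff {n : ℕ} {t q p : Fin n → ℝ} (hp : ∀ i, 0 ≤ p i) {ξ : SearchSeq n}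
    (h : ∀ i, expectedTime t q ξ i ≠ ⊤) :
    (hiderPayoff t q p ξ).toReal = ∑ i, p i * timeVector t q ξ i := by
  unfold hiderPayoff timeVector
  rw [ENNReal.toReal_sum fun i _ => ENNReal.mul_ne_top ENNReal.ofReal_ne_top (h i)]
  refine Finset.sum_congr rfl fun i _ => ?_
  rw [ENNReal.toReal_mul, ENNReal.toReal_ofReal (hp i)]

/-- On Gittins sequences the weighted times have constant sum. Each is lower semicontinuous and is
also a constant minus lower semicontinuous terms, hence upper semicontinuous. -/
lemma continuousOn_timeVector {n : ℕ} (hn : 1 ≤ n) {t q p : Fin n → ℝ} (ht : ∀ i, 0 < t i)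
    (hq : ∀ i, 0 < q i ∧ q i < 1) (hp : ∀ i, 0 < p i) :
    ContinuousOn (timeVector t q) {ξ | IsGittins t q p ξ} := by
  refine continuousOn_pi.2 fun i => ?_
  let G : Set (SearchSeq n) := {ξ | IsGittins t q p ξ}
  have hfin : ∀ ξ ∈ G, ∀ i, expectedTime t q ξ i ≠ ⊤ := fun ξ hξ =>
    IsGittins.expectedTime_ne_top hn ht hq hp hξ
  have hv : hiderGuarantee t q p ≠ ⊤ := by
    rw [← finiteGuarantee_eq_hiderGuarantee hn ht hq hp]
    exact finiteGuarantee_ne_top hn ht hq p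
  let rest : SearchSeq n → ℝ≥0∞ := fun ξ =>
    ∑ j ∈ Finset.univ.erase i, ENNReal.ofReal (p j) * expectedTime t q ξ j
  have hrest : ∀ ξ ∈ G, ENNReal.ofReal (p i) * expectedTime t q ξ i =
      hiderGuarantee t q p - rest ξ := by
    intro ξ hξ
    have hne : rest ξ ≠ ⊤ := ENNReal.sum_ne_top.2 fun j _ =>
      ENNReal.mul_ne_top ENNReal.ofReal_ne_top (hfin ξ hξ j)
    refine ENNReal.eq_sub_of_add_eq hne ?_
    rw [← IsGittins.hiderPayoff_eq ht hq hp hξ, hiderPayoff]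
    exact Finset.add_sum_erase _ (fun j => ENNReal.ofReal (p j) * expectedTime t q ξ j)
      (Finset.mem_univ i)
  have hlower := lowerSemicontinuous_const_mul_expectedTime ht hq (p i) i
  have hupper : UpperSemicontinuous fun ξ => hiderGuarantee t q p - rest ξ :=
    (ENNReal.continuous_sub_left hv).comp_lowerSemicontinuous_antitone
      (lowerSemicontinuous_sum fun j _ => lowerSemicontinuous_const_mul_expectedTime ht hq (p j) j)
      fun _ _ h => tsub_le_tsub_left h _
  have hcont : ContinuousOn (fun ξ => ENNReal.ofReal (p i) * expectedTime t q ξ i) G := by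
    refine continuousOn_iff_lower_upperSemicontinuousOn.2 ⟨hlower.lowerSemicontinuousOn _, ?_⟩
    intro ξ hξ y hy
    have hy' : ENNReal.ofReal (p i) * expectedTime t q ξ i < y := hy
    rw [hrest ξ hξ] at hy'
    filter_upwards [hupper.upperSemicontinuousOn G ξ hξ y hy', self_mem_nhdsWithin] with ξ' h1 h2
    rwa [hrest ξ' h2]
  have hreal : ContinuousOn
      (fun ξ => (p i)⁻¹ * (ENNReal.ofReal (p i) * expectedTime t q ξ i).toReal) G := by
    refine ContinuousOn.mul continuousOn_const ?_
    refine ENNReal.continuousOn_toReal.comp hcont fun ξ hξ => ?_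
    exact ENNReal.mul_ne_top ENNReal.ofReal_ne_top (hfin ξ hξ i)
  refine hreal.congr fun ξ _ => ?_
  beta_reduce
  rw [ENNReal.toReal_mul, ENNReal.toReal_ofReal (hp i).le, inv_mul_cancel_left₀ (hp i).ne']
  rfl

/-- The constant vector of the value is a convex combination of time vectors of Gittins search
sequences against a maximizing hiding strategy. -/
lemma MaximizesFiniteGuarantee.const_mem_convexHull {n : ℕ} (hn : 1 ≤ n) {t q p : Fin n → ℝ}
    (ht : ∀ i, 0 < t i) (hq : ∀ i, 0 < q i ∧ q i < 1) (hp : MaximizesFiniteGuarantee t q p) :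
    (fun _ => (finiteGuarantee t q p).toReal) ∈
      convexHull ℝ (timeVector t q '' {ξ | IsGittins t q p ξ}) := by
  have hpos := hp.pos hn ht hq
  have : Nonempty (Fin n) := ⟨⟨0, hn⟩⟩
  set v := finiteGuarantee t q p with hv
  by_contra hnot
  obtain ⟨f, u, hfu, huf⟩ := geometric_hahn_banach_point_closed (convex_convexHull ℝ _)
    (isCompact_convexHull_of_isCompact ((isCompact_setOf_isGittins t q p).image_of_continuousOn
      (continuousOn_timeVector hn ht hq hpos))).isClosed hnot
  let c : Fin n → ℝ := fun i => f fun j => if i = j then 1 else 0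
  have hf : ∀ x, f x = ∑ i, c i * x i := fun x => by
    have h := LinearMap.pi_apply_eq_sum_univ (f : (Fin n → ℝ) →ₗ[ℝ] ℝ) x
    simp only [ContinuousLinearMap.coe_coe, smul_eq_mul] at h
    rw [h]
    exact Finset.sum_congr rfl fun i _ => mul_comm _ _
  obtain ⟨j, hj⟩ := Finite.exists_max fun i => -c i / p i
  -- Taking `r` above every `-c i / p i` makes `c + r p` positive. On the hyperplane `∑ p i * x i =
  -- v`, which also contains the constant vector `v`, this shifts the functional by a constant, so
  -- the separation persists.
  let r : ℝ := -c j / p j + 1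
  let W : Fin n → ℝ := fun i => c i + r * p i
  have hW : ∀ i, 0 < W i := by
    intro i
    have h1 : -c i / p i < r := by linarith [hj i]
    rw [div_lt_iff₀ (hpos i)] at h1
    change 0 < c i + r * p i
    linarith
  have hs : 0 < ∑ i, W i := Finset.sum_pos (fun i _ => hW i) Finset.univ_nonempty
  have hw : ∀ i, 0 < (fun i => W i / ∑ i, W i) i := fun i => div_pos (hW i) hs
  obtain ⟨ξ, hξ, hle⟩ := hp.exists_isGittins_hiderPayoff_le hn ht hq
    (w := fun i => W i / ∑ i, W i)
    ⟨fun i => (hw i).le, by rw [← Finset.sum_div, div_self hs.ne']⟩ hw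
  have hfin := hξ.expectedTime_ne_top hn ht hq hpos
  have hpay : ∑ i, p i * timeVector t q ξ i = v.toReal := by
    rw [← toReal_hiderPayoff (fun i => (hpos i).le) hfin, hξ.hiderPayoff_eq ht hq hpos, hv,
      finiteGuarantee_eq_hiderGuarantee hn ht hq hpos]
  have hle' := ENNReal.toReal_mono (finiteGuarantee_ne_top hn ht hq p) hle
  rw [toReal_hiderPayoff (fun i => (hw i).le) hfin, ← hv] at hle'
  simp only [div_mul_eq_mul_div] at hle'
  rw [← Finset.sum_div, div_le_iff₀ hs] at hle'
  have hlt := hfu.trans (huf _ (subset_convexHull ℝ _ ⟨ξ, hξ, rfl⟩))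
  rw [hf, hf, ← Finset.sum_mul] at hlt
  simp only [W, add_mul, mul_assoc, Finset.sum_add_distrib, ← Finset.mul_sum, hpay, hp.1.2,
    mul_one] at hle'
  linarith

/-- Against a maximizing hiding strategy there is a mixture of at most `n` Gittins search
sequences whose expected time is the value in every box. -/
lemma MaximizesFiniteGuarantee.exists_mixture {n : ℕ} (hn : 1 ≤ n) {t q p : Fin n → ℝ}
    (ht : ∀ i, 0 < t i) (hq : ∀ i, 0 < q i ∧ q i < 1) (hp : MaximizesFiniteGuarantee t q p) :
    ∃ η : PMF (SearchSeq n), (∀ i, mixedTime t q η i = finiteGuarantee t q p) ∧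
      η.support.encard ≤ n ∧ ∀ ξ ∈ η.support, IsGittins t q p ξ := by
  have hpos := hp.pos hn ht hq
  obtain ⟨ι, _, z, w, hz, hind, hw0, hw1, hwz⟩ :=
    eq_pos_convex_span_of_mem_convexHull (hp.const_mem_convexHull hn ht hq)
  choose X hX hXz using fun a => hz (Set.mem_range_self a)
  have hfin : ∀ a i, expectedTime t q (X a) i ≠ ⊤ := fun a =>
    IsGittins.expectedTime_ne_top hn ht hq hpos (hX a)
  have hcard : Fintype.card ι ≤ n := by
    refine card_le_of_affineIndependent_of_sum_mul_eq hind (p := p)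
      (c := (hiderGuarantee t q p).toReal) ?_ fun a => ?_
    · rintro rfl
      exact lt_irrefl _ (hpos ⟨0, hn⟩)
    · rw [← hXz a, ← toReal_hiderPayoff (fun i => (hpos i).le) (hfin a),
        IsGittins.hiderPayoff_eq ht hq hpos (hX a)]
  have hsum : ∑ a, ENNReal.ofReal (w a) = 1 := by
    rw [← ENNReal.ofReal_sum_of_nonneg fun a _ => (hw0 a).le, hw1, ENNReal.ofReal_one]
  refine ⟨(PMF.ofFintype _ hsum).map X, fun i => ?_, ?_, fun ξ hξ => ?_⟩
  · rw [mixedTime_map, tsum_fintype,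
      ← ENNReal.ofReal_toReal (finiteGuarantee_ne_top hn ht hq p)]
    have h := congrFun hwz i
    simp only [Finset.sum_apply, Pi.smul_apply, smul_eq_mul] at h
    rw [← h, ENNReal.ofReal_sum_of_nonneg]
    · refine Finset.sum_congr rfl fun a _ => ?_
      rw [PMF.ofFintype_apply, ENNReal.ofReal_mul (hw0 a).le, ← hXz a, timeVector,
        ENNReal.ofReal_toReal (hfin a i)]
    · intro a _
      rw [← hXz a]
      exact mul_nonneg (hw0 a).le ENNReal.toReal_nonneg
  · rw [PMF.support_map]
    calc _ ≤ (PMF.ofFintype _ hsum).support.encard := Set.encard_image_le _ _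
      _ ≤ (Set.univ : Set ι).encard := Set.encard_le_encard (Set.subset_univ _)
      _ = Fintype.card ι := by rw [Set.encard_univ, ENat.card_eq_coe_fintype_card]
      _ ≤ n := by exact_mod_cast hcard
  · rw [PMF.support_map] at hξ
    obtain ⟨a, _, rfl⟩ := hξ
    exact hX a

lemma MaximizesFiniteGuarantee.upperValue_eq {n : ℕ} (hn : 1 ≤ n) {t q p : Fin n → ℝ}
    (ht : ∀ i, 0 < t i) (hq : ∀ i, 0 < q i ∧ q i < 1) (hp : MaximizesFiniteGuarantee t q p) :
    upperValue t q = finiteGuarantee t q p := by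
  obtain ⟨η, hη, -⟩ := hp.exists_mixture hn ht hq
  refine le_antisymm ((iInf_le _ η).trans (iSup_le fun i => (hη i).le)) (le_iInf fun η' => ?_)
  rw [finiteGuarantee_eq_hiderGuarantee hn ht hq (hp.pos hn ht hq)]
  exact hiderGuarantee_le_searcherGuarantee t q hp.1 η'

lemma MaximizesFiniteGuarantee.isOptimalSearch {n : ℕ} (hn : 1 ≤ n) {t q p : Fin n → ℝ}
    (ht : ∀ i, 0 < t i) (hq : ∀ i, 0 < q i ∧ q i < 1) (hp : MaximizesFiniteGuarantee t q p)
    {η : PMF (SearchSeq n)} (hη : ∀ i, mixedTime t q η i = finiteGuarantee t q p) :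
    IsOptimalSearch t q η := by
  have : Nonempty (Fin n) := ⟨⟨0, hn⟩⟩
  rw [IsOptimalSearch, searcherGuarantee, hp.upperValue_eq hn ht hq]
  simp only [hη, ciSup_const]

end SearchGame

theorem theorem3p1 (n : ℕ) (hn : 1 ≤ n) (t q : Fin n → ℝ)
    (ht : ∀ i, 0 < t i) (hq : ∀ i, 0 < q i ∧ q i < 1) :
    SearchGame.lowerValue t q = SearchGame.upperValue t q ∧
    (∃ η : PMF (SearchGame.SearchSeq n), SearchGame.IsOptimalSearch t q η) ∧
    ∀ p : Fin n → ℝ, SearchGame.IsOptimalHiding t q p →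
      ∃ η : PMF (SearchGame.SearchSeq n),
        SearchGame.IsOptimalSearch t q η ∧
        η.support.encard ≤ n ∧
        ∀ ξ ∈ η.support, SearchGame.IsGittins t q p ξ := by
  obtain ⟨p₀, hp₀⟩ := SearchGame.exists_maximizesFiniteGuarantee hn t q
  refine ⟨?_, ?_, fun p hp => ?_⟩
  · rw [hp₀.lowerValue_eq hn ht hq, hp₀.upperValue_eq hn ht hq]
  · obtain ⟨η, hη, -⟩ := hp₀.exists_mixture hn ht hq
    exact ⟨η, hp₀.isOptimalSearch hn ht hq hη⟩
  · have hp' := hp.maximizesFiniteGuarantee hn ht hq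
    obtain ⟨η, hη, hcard, hgit⟩ := hp'.exists_mixture hn ht hq
    exact ⟨η, hp'.isOptimalSearch hn ht hq hη, hcard, hgit⟩
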